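/- For $n\in\mathbb Z$ let $J_n(t)=\frac1{2\pi}\int_{\mathbb R/2\pi\mathbb Z}e^{i(n\alpha-t\sin\alpha)}\,d\alpha$ be the Bessel function, and for $k\ge 0$ let $\lambda_{k,n}>0$ be its $k$-th positive zero (counted from $k=0$); the $\lambda_{k,n}$ are the eigenvalues of $\sqrt{-\Delta}$ on the unit disk with Dirichlet condition. For $\varepsilon>0$, $\lambda\ge 1$ and $\delta>0$ let $$Z=\{\,n\ge 0:\ \text{there is } k\ge 0 \text{ with } \lambda_{k,n}\in[\lambda-\delta,\lambda+\delta]\text{ and } n\le(1-\varepsilon/2)\lambda_{k,n}\,\},$$ $$T=\{\,\mathbf n=(n_1,n_2,n_3,n_4)\in Z^4:\ n_1\le n_2\le n_3\le n_4,\ n_1+n_4=n_2+n_3\,\},$$ and for $\mathbf n\in T$ let $s(\mathbf n)=n_2-n_1$ be its side and $b(\mathbf n)=n_4-n_1$ its base. **Proposition 4.2 (label uncertainty, "quadrilateral Jarník lemma").** For every $\varepsilon>0$ there are constants $C,c>0$, depending only on $\varepsilon$, such that for all $\lambda\ge 1$ and $\delta\ge\lambda^{-1}$ the following holds. 1. If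 $\mathbf n\in T$ and $s(\mathbf n)\,b(\mathbf n)\ge C\lambda\delta$, then $s(\mathbf n)\,b(\mathbf n)\ge c\lambda$. 2. Let $\mathbf n=(n_1,n_2,n_3,n_4)\in T$ with $s(\mathbf n)\,b(\mathbf n)\ge C\lambda\delta$, and let $\mathbf n'=(n_1',n_2,n_3,n_4')\in T$ have the same second and third entries, with $\sigma:=s(\mathbf n')-s(\mathbf n)>0$. If $\sigma\,b(\mathbf n)\ge C\lambda\delta$, then $\sigma\,b(\mathbf n)\ge c\lambda$. -/

import Mathlib

open Real

noncomputable section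

/-- The Bessel function of integer order
`J_n(t) = (1 / 2π) ∫_{ℝ/2πℤ} exp (i (n α - t sin α)) dα`. -/
def besselJ (n : ℤ) (t : ℝ) : ℂ :=
  (1 / (2 * (π : ℂ))) *
    ∫ α in (0 : ℝ)..(2 * π),
      Complex.exp (Complex.I * (((n : ℝ) * α - t * Real.sin α : ℝ) : ℂ))

/-- `x` is the `k`-th positive zero of `J_n`, counted from `k = 0`
(this is the relation `x = λ_{k,n}`): it is a positive zero, and exactly `k` positive zeros
lie below it. -/
def IsBesselZero (k : ℕ) (n : ℤ) (x : ℝ) : Prop :=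
  0 < x ∧ besselJ n x = 0 ∧ {y : ℝ | 0 < y ∧ y < x ∧ besselJ n y = 0}.encard = k

/-- The pairs `(k, n)` with `k, n ≥ 0`, `λ_{k,n} ∈ [lam - δ, lam + δ]` and
`n ≤ (1 - ε / 2) λ_{k,n}`. -/
def spectralPairs (ε lam δ : ℝ) : Set (ℕ × ℤ) :=
  {p | 0 ≤ p.2 ∧ ∃ x : ℝ, IsBesselZero p.1 p.2 x ∧
    x ∈ Set.Icc (lam - δ) (lam + δ) ∧ (p.2 : ℝ) ≤ (1 - ε / 2) * x}

/-- The set `Z` of angular indices: the projection of the set of pairs `(k, n)` on the second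
coordinate. -/
def angularIndices (ε lam δ : ℝ) : Set ℤ :=
  Prod.snd '' spectralPairs ε lam δ

/-- The set `T` of zero sum sets. The entries `n₁, n₂, n₃, n₄` are `n 0, n 1, n 2, n 3`. -/
def zeroSumSets (ε lam δ : ℝ) : Set (Fin 4 → ℤ) :=
  {n | (∀ i, n i ∈ angularIndices ε lam δ) ∧
    n 0 ≤ n 1 ∧ n 1 ≤ n 2 ∧ n 2 ≤ n 3 ∧ n 0 + n 3 = n 1 + n 2}

/-- The side `s(n) = n₂ - n₁` (which equals `n₄ - n₃` on a zero sum set). -/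
def side (n : Fin 4 → ℤ) : ℤ := n 1 - n 0

/-- The base `b(n) = n₄ - n₁`. -/
def base (n : Fin 4 → ℤ) : ℤ := n 3 - n 0

end

/-!
The zeros of `J_n` are read off from its phase. Put
`θ_n(t) = √(t² - n²) - n arccos (n / t)` (`besselPhase`). On the region `n ≤ (1 - e) t` the
Liouville-Green substitution `P = (t² - n²)^{1/4} J_n`, with `θ_n` as independent variable, turns
Bessel's equation into a harmonic oscillator with a perturbation of size `O(1 / t²)`. Hence
`exp (i θ_n) (P + i dP/dθ_n)` (`lgFrame`) converges at infinity, and at `t = x` it differs from its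
limit by a factor `1 + O(1 / x)` (`norm_lgFrame_sub_le`). The recurrences between `J_n` and `J_{n+1}`
show that the limit is the same nonzero constant for every `n` (`exists_tendsto_lgFrame`). At a zero
`x` of `J_n` the value `P` vanishes, so `θ_n(x) = ψ + k π + O(1 / x)` with an integer `k` and a
constant `ψ` independent of `n` (`exists_besselPhase_zero`).

For four indices `p, p + s, p + t, p + s + t` in `Z` the second difference of `ν ↦ θ_ν(lam + δ)` is
therefore within `O(δ)` of a multiple of `π`. On the other hand
`∂²θ_ν(r)/∂ν² = (r² - ν²)^{-1/2}`, so for bounded `δ` this second difference is comparable to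
`s t / lam`. If `s t` is at least a large multiple of `lam δ`, the multiple of `π` is not zero,
so that `s t` is at least a constant times `lam` (`exists_gap`). Both assertions are instances of this gap: the first for
`n₁, n₂, n₃, n₄`, the second for `n₁ - σ, n₁, n₄, n₄ + σ`. The gap needs `δ` below a constant; for
larger `δ` the assertions are immediate.
-/

noncomputable section

open Filter Topology Asymptotics

/-! ### Recurrences and Bessel's equation -/

/-- The real part of `besselJ n t`. Only this part is needed: it vanishes at every zero of
`besselJ n`. -/
def realBesselJ (n : ℤ) (t : ℝ) : ℝ :=
  1 / (2 * π) * ∫ α in (0 : ℝ)..(2 * π), cos (n * α - t * sin α)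

theorem re_besselJ (n : ℤ) (t : ℝ) : (besselJ n t).re = realBesselJ n t := by
  have h : (∫ α in (0 : ℝ)..(2 * π),
      Complex.exp (Complex.I * (((n : ℝ) * α - t * Real.sin α : ℝ) : ℂ))).re
      = ∫ α in (0 : ℝ)..(2 * π), cos (n * α - t * sin α) := by
    rw [← Complex.reCLM_apply, ← ContinuousLinearMap.intervalIntegral_comp_comm]
    · refine intervalIntegral.integral_congr fun α _ => ?_
      simp only [Complex.reCLM_apply]
      rw [mul_comm, Complex.exp_ofReal_mul_I_re]
    · exact Continuous.intervalIntegrable (by fun_prop) _ _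
  have h2 : (1 / (2 * (π : ℂ))) = ((1 / (2 * π) : ℝ) : ℂ) := by push_cast; rfl
  rw [besselJ, h2, Complex.re_ofReal_mul, h, realBesselJ]

theorem realBesselJ_zero_zero : realBesselJ 0 0 = 1 := by
  have := pi_pos
  simp [realBesselJ]
  field_simp

theorem hasDerivAt_realBesselJ_integral (n : ℤ) (t : ℝ) :
    HasDerivAt (realBesselJ n)
      (1 / (2 * π) * ∫ α in (0 : ℝ)..(2 * π), sin (n * α - t * sin α) * sin α) t := by
  refine HasDerivAt.const_mul _ ?_
  refine (intervalIntegral.hasDerivAt_integral_of_dominated_loc_of_deriv_le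
    (F := fun t α => cos (n * α - t * sin α))
    (F' := fun t α => sin (n * α - t * sin α) * sin α) (bound := fun _ => 1)
    (s := Set.univ) Filter.univ_mem ?_ ?_ ?_ ?_ ?_ ?_).2
  · exact .of_forall fun x => Continuous.aestronglyMeasurable (by fun_prop)
  · exact Continuous.intervalIntegrable (by fun_prop) _ _
  · exact Continuous.aestronglyMeasurable (by fun_prop)
  · refine .of_forall fun α _ x _ => ?_
    rw [norm_mul]
    exact mul_le_one₀ (abs_sin_le_one _) (norm_nonneg _) (abs_sin_le_one _)
  · exact Continuous.intervalIntegrable (by fun_prop) _ _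
  · refine .of_forall fun α _ x _ => ?_
    have h : HasDerivAt (fun x : ℝ => n * α - x * sin α) (-sin α) x := by
      simpa using ((hasDerivAt_id x).mul_const (sin α)).const_sub (n * α)
    exact h.cos.congr_deriv (by ring)

/-- The relation `J_{n-1} - J_{n+1} = 2 J_n'`. -/
theorem hasDerivAt_realBesselJ_half (n : ℤ) (t : ℝ) :
    HasDerivAt (realBesselJ n) ((realBesselJ (n - 1) t - realBesselJ (n + 1) t) / 2) t := by
  convert hasDerivAt_realBesselJ_integral n t using 1
  simp only [realBesselJ]
  rw [← mul_sub, ← intervalIntegral.integral_sub, mul_div_assoc, ← intervalIntegral.integral_div]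
  · congr 1
    refine intervalIntegral.integral_congr fun α _ => ?_
    have h1 : ((n - 1 : ℤ) : ℝ) * α - t * sin α = (n * α - t * sin α) - α := by push_cast; ring
    have h2 : ((n + 1 : ℤ) : ℝ) * α - t * sin α = (n * α - t * sin α) + α := by push_cast; ring
    simp only [h1, h2, cos_add, cos_sub]
    ring
  · exact Continuous.intervalIntegrable (by fun_prop) _ _
  · exact Continuous.intervalIntegrable (by fun_prop) _ _

/-- The relation `t (J_{n-1} + J_{n+1}) = 2 n J_n`: the difference of the two sides is the integral
of the derivative of `sin (n α - t sin α)` over a period. -/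
theorem mul_realBesselJ_add (n : ℤ) (t : ℝ) :
    t * (realBesselJ (n - 1) t + realBesselJ (n + 1) t) = 2 * n * realBesselJ n t := by
  have key : ∫ α in (0 : ℝ)..(2 * π), cos (n * α - t * sin α) * (n - t * cos α) = 0 := by
    rw [intervalIntegral.integral_eq_sub_of_hasDerivAt
      (f := fun α => sin (n * α - t * sin α))]
    · have : (n : ℝ) * (2 * π) = 0 + n * (2 * π) := by ring
      simp only [sin_two_pi, sin_zero, mul_zero, sub_zero]
      rw [this, sin_add_int_mul_two_pi]
      simp
    · intro α _
      have h : HasDerivAt (fun α : ℝ => n * α - t * sin α) (n - t * cos α) α := by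
        exact (((hasDerivAt_id α).const_mul (n : ℝ)).fun_sub
          ((hasDerivAt_sin α).const_mul t)).congr_deriv (by simp)
      exact h.sin
    · exact Continuous.intervalIntegrable (by fun_prop) _ _
  have h1 : t * (realBesselJ (n - 1) t + realBesselJ (n + 1) t) - 2 * n * realBesselJ n t
      = 1 / (2 * π) * (-2 * ∫ α in (0 : ℝ)..(2 * π),
          cos (n * α - t * sin α) * (n - t * cos α)) := by
    simp only [realBesselJ]
    rw [← mul_add, ← intervalIntegral.integral_add, mul_left_comm, mul_left_comm (2 * (n : ℝ)),
      ← mul_sub, ← intervalIntegral.integral_const_mul, ← intervalIntegral.integral_const_mul,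
      ← intervalIntegral.integral_const_mul, ← intervalIntegral.integral_sub]
    · congr 1
      refine intervalIntegral.integral_congr fun α _ => ?_
      have h1 : ((n - 1 : ℤ) : ℝ) * α - t * sin α = (n * α - t * sin α) - α := by
        push_cast; ring
      have h2 : ((n + 1 : ℤ) : ℝ) * α - t * sin α = (n * α - t * sin α) + α := by
        push_cast; ring
      simp only [h1, h2, cos_add, cos_sub]
      ring
    all_goals exact Continuous.intervalIntegrable (by fun_prop) _ _
  rw [key] at h1
  linarith

/-- The derivative of `J_n` for `t ≠ 0`, defined through the recurrence
`J_n' = (n / t) J_n - J_{n+1}`. -/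
def realBesselJDeriv (n : ℤ) (t : ℝ) : ℝ := n / t * realBesselJ n t - realBesselJ (n + 1) t

theorem hasDerivAt_realBesselJ (n : ℤ) {t : ℝ} (ht : t ≠ 0) :
    HasDerivAt (realBesselJ n) (realBesselJDeriv n t) t := by
  convert hasDerivAt_realBesselJ_half n t using 1
  have := mul_realBesselJ_add n t
  rw [realBesselJDeriv]
  field_simp
  linarith

theorem realBesselJDeriv_add_one (n : ℤ) {t : ℝ} (ht : t ≠ 0) :
    realBesselJDeriv (n + 1) t = realBesselJ n t - (n + 1) / t * realBesselJ (n + 1) t := by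
  have := mul_realBesselJ_add (n + 1) t
  rw [add_sub_cancel_right] at this
  push_cast at this
  rw [realBesselJDeriv]
  push_cast
  field_simp
  linarith

/-- Bessel's equation. -/
theorem hasDerivAt_realBesselJDeriv (n : ℤ) {t : ℝ} (ht : t ≠ 0) :
    HasDerivAt (realBesselJDeriv n)
      (-(realBesselJDeriv n t / t) - (1 - n ^ 2 / t ^ 2) * realBesselJ n t) t := by
  have h1 : HasDerivAt (fun t : ℝ => (n : ℝ) / t) (-n / t ^ 2) t := by
    exact ((hasDerivAt_const t (n : ℝ)).fun_div (hasDerivAt_id t) ht).congr_deriv (by simp)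
  have h := (h1.mul (hasDerivAt_realBesselJ n ht)).sub (hasDerivAt_realBesselJ (n + 1) ht)
  rw [realBesselJDeriv_add_one n ht] at h
  refine h.congr_deriv ?_
  rw [realBesselJDeriv]
  field_simp
  ring

theorem continuous_realBesselJ (n : ℤ) : Continuous (realBesselJ n) :=
  continuous_iff_continuousAt.2 fun t => (hasDerivAt_realBesselJ_half n t).continuousAt

/-- `J₀` and `J₀'` have no common positive zero: `t² (J₀² + J₀'²)` has derivative `2 t J₀² ≥ 0`, so a
common zero would force `J₀ = 0` on the left of it, against `J₀(0) = 1`. -/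
theorem realBesselJ_zero_sq_add_pos {x : ℝ} (hx : 0 < x) :
    0 < realBesselJ 0 x ^ 2 + realBesselJDeriv 0 x ^ 2 := by
  by_contra hcon
  have h0 : realBesselJ 0 x ^ 2 + realBesselJDeriv 0 x ^ 2 = 0 :=
    le_antisymm (not_lt.1 hcon) (by positivity)
  have hd : ∀ t, t ≠ 0 → HasDerivAt
      (fun t => t ^ 2 * (realBesselJ 0 t ^ 2 + realBesselJDeriv 0 t ^ 2))
      (2 * t * realBesselJ 0 t ^ 2) t := by
    intro t ht
    have h := (hasDerivAt_pow 2 t).mul (((hasDerivAt_realBesselJ 0 ht).pow 2).add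
      ((hasDerivAt_realBesselJDeriv 0 ht).pow 2))
    refine h.congr_deriv ?_
    simp
    field_simp
    ring
  have hz : ∀ t ∈ Set.Ioo 0 x, realBesselJ 0 t = 0 := by
    intro t ht
    have hm : MonotoneOn (fun t => t ^ 2 * (realBesselJ 0 t ^ 2 + realBesselJDeriv 0 t ^ 2))
        (Set.Icc t x) := by
      refine monotoneOn_of_deriv_nonneg (convex_Icc _ _) ?_ ?_ ?_
      · exact fun s hs => (hd s (ht.1.trans_le hs.1).ne').continuousAt.continuousWithinAt
      · rw [interior_Icc]
        exact fun s hs => (hd s (ht.1.trans hs.1).ne').differentiableAt.differentiableWithinAt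
      · rw [interior_Icc]
        intro s hs
        have := ht.1.trans hs.1
        rw [(hd s this.ne').deriv]
        positivity
    have h := hm (Set.left_mem_Icc.2 ht.2.le) (Set.right_mem_Icc.2 ht.2.le) ht.2.le
    simp only [h0, mul_zero] at h
    have ht2 : 0 < t ^ 2 := pow_pos ht.1 2
    have : realBesselJ 0 t ^ 2 + realBesselJDeriv 0 t ^ 2 ≤ 0 := by
      by_contra hneg
      exact absurd h (not_le.2 (mul_pos ht2 (not_le.1 hneg)))
    have : realBesselJ 0 t ^ 2 = 0 :=
      le_antisymm (by nlinarith [sq_nonneg (realBesselJDeriv 0 t)]) (sq_nonneg _)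
    simpa using this
  have hlim : Filter.Tendsto (realBesselJ 0) (nhdsWithin 0 (Set.Ioi 0)) (nhds 1) := by
    have := (continuous_realBesselJ 0).tendsto 0
    rw [realBesselJ_zero_zero] at this
    exact this.mono_left nhdsWithin_le_nhds
  have hlim0 : Filter.Tendsto (realBesselJ 0) (nhdsWithin 0 (Set.Ioi 0)) (nhds 0) := by
    refine tendsto_const_nhds.congr' ?_
    filter_upwards [Ioo_mem_nhdsGT hx] with t ht
    exact (hz t ht).symm
  exact zero_ne_one (tendsto_nhds_unique hlim0 hlim)

/-! ### A Gronwall estimate -/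

/-- Gronwall's inequality with the integrable rate `K / t²`. -/
theorem norm_sub_le_of_norm_deriv_le_div_sq {f f' : ℝ → ℂ} {K x : ℝ} (hK : 0 ≤ K) (hx : 0 < x)
    (hf : ∀ t, x ≤ t → HasDerivAt f (f' t) t) (hf' : ∀ t, x ≤ t → ‖f' t‖ ≤ K / t ^ 2 * ‖f t‖)
    {t : ℝ} (ht : x ≤ t) : ‖f t - f x‖ ≤ K * exp (K / x) * ‖f x‖ / x := by
  have hexp : ∀ s, s ≠ 0 → HasDerivAt (fun s => exp (2 * K / s))
      (exp (2 * K / s) * (-(2 * K) / s ^ 2)) s := fun s hs =>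
    (((hasDerivAt_const s (2 * K)).fun_div (hasDerivAt_id s) hs).congr_deriv (by simp)).exp
  have hd : ∀ s, x ≤ s → HasDerivAt (fun s => ‖f s‖ ^ 2 * exp (2 * K / s))
      (2 * inner ℝ (f s) (f' s) * exp (2 * K / s)
        + ‖f s‖ ^ 2 * (exp (2 * K / s) * (-(2 * K) / s ^ 2))) s := fun s hs =>
    (hf s hs).norm_sq.fun_mul (hexp s (hx.trans_le hs).ne')
  have hanti : AntitoneOn (fun s => ‖f s‖ ^ 2 * exp (2 * K / s)) (Set.Ici x) := by
    refine antitoneOn_of_deriv_nonpos (convex_Ici _) ?_ ?_ ?_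
    · exact fun s hs => (hd s hs).continuousAt.continuousWithinAt
    · rw [interior_Ici]
      exact fun s hs => (hd s (le_of_lt hs)).differentiableAt.differentiableWithinAt
    · rw [interior_Ici]
      intro s hs
      rw [(hd s (le_of_lt hs)).deriv]
      have h1 : inner ℝ (f s) (f' s) ≤ K / s ^ 2 * ‖f s‖ ^ 2 := by
        calc inner ℝ (f s) (f' s) ≤ ‖f s‖ * ‖f' s‖ := real_inner_le_norm _ _
          _ ≤ ‖f s‖ * (K / s ^ 2 * ‖f s‖) := by gcongr; exact hf' s (le_of_lt hs)
          _ = _ := by ring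
      have h2 := mul_le_mul_of_nonneg_right h1 (exp_pos (2 * K / s)).le
      calc _ = 2 * (inner ℝ (f s) (f' s) * exp (2 * K / s)
            - K / s ^ 2 * ‖f s‖ ^ 2 * exp (2 * K / s)) := by ring
        _ ≤ 0 := by linarith
  have hbd : ∀ s, x ≤ s → ‖f s‖ ≤ exp (K / x) * ‖f x‖ := by
    intro s hs
    have h1 := hanti Set.self_mem_Ici hs hs
    have hs0 := hx.trans_le hs
    have h2 : 1 ≤ exp (2 * K / s) := one_le_exp (by positivity)
    have h3 : ‖f s‖ ^ 2 ≤ (exp (K / x) * ‖f x‖) ^ 2 := by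
      calc ‖f s‖ ^ 2 ≤ ‖f s‖ ^ 2 * exp (2 * K / s) := le_mul_of_one_le_right (by positivity) h2
        _ ≤ ‖f x‖ ^ 2 * exp (2 * K / x) := h1
        _ = _ := by rw [mul_pow, ← exp_nat_mul]; push_cast; ring_nf
    exact le_of_sq_le_sq h3 (by positivity)
  set M := K * exp (K / x) * ‖f x‖ with hM
  have hB : ∀ s, s ≠ 0 → HasDerivAt (fun s => M * (1 / x - 1 / s)) (M / s ^ 2) s := fun s hs => by
    have h : HasDerivAt (fun s : ℝ => 1 / s) (-1 / s ^ 2) s :=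
      ((hasDerivAt_const s (1 : ℝ)).fun_div (hasDerivAt_id s) hs).congr_deriv (by simp)
    exact ((h.const_sub (1 / x)).const_mul M).congr_deriv (by ring)
  have hpos : ∀ s ∈ Set.Icc x t, 0 < s := fun s hs => hx.trans_le hs.1
  have h := image_norm_le_of_norm_deriv_right_le_deriv_boundary'
    (f := fun s => f s - f x) (f' := f') (a := x) (b := t)
    (B := fun s => M * (1 / x - 1 / s)) (B' := fun s => M / s ^ 2)
    (fun s hs => ((hf s hs.1).sub_const _).continuousAt.continuousWithinAt)
    (fun s hs => ((hf s hs.1).sub_const _).hasDerivWithinAt) (by simp)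
    (fun s hs => (hB s (hpos s hs).ne').continuousAt.continuousWithinAt)
    (fun s hs => (hB s (hx.trans_le hs.1).ne').hasDerivWithinAt)
    (fun s hs => by
      have := hpos s ⟨hs.1, hs.2.le⟩
      calc ‖f' s‖ ≤ K / s ^ 2 * ‖f s‖ := hf' s hs.1
        _ ≤ K / s ^ 2 * (exp (K / x) * ‖f x‖) := by gcongr; exact hbd s hs.1
        _ = M / s ^ 2 := by rw [hM]; ring)
    (Set.right_mem_Icc.2 ht)
  have ht0 : 0 < t := hx.trans_le ht
  calc ‖f t - f x‖ ≤ M * (1 / x - 1 / t) := h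
    _ ≤ M * (1 / x) := by
      have : 0 < 1 / t := by positivity
      have : 0 ≤ M := by positivity
      gcongr; linarith
    _ = M / x := by ring

/-! ### The phase and the amplitude -/

/-- The phase `√(t² - ν²) - ν arccos (ν / t)` of `J_ν` in the oscillatory region `t > ν`. -/
def besselPhase (ν t : ℝ) : ℝ := √(t ^ 2 - ν ^ 2) - ν * arccos (ν / t)

theorem sqrt_one_sub_div_sq {ν t : ℝ} (ht : 0 < t) :
    √(1 - (ν / t) ^ 2) = √(t ^ 2 - ν ^ 2) / t := by
  have : 1 - (ν / t) ^ 2 = (t ^ 2 - ν ^ 2) / t ^ 2 := by field_simp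
  rw [this, sqrt_div' _ (by positivity), sqrt_sq ht.le]

theorem hasDerivAt_sqrt_sq_sub_sq {ν t : ℝ} (hν : 0 ≤ ν) (ht : ν < t) :
    HasDerivAt (fun t => √(t ^ 2 - ν ^ 2)) (t / √(t ^ 2 - ν ^ 2)) t := by
  have h1 : 0 < t ^ 2 - ν ^ 2 := by nlinarith
  exact (((hasDerivAt_pow 2 t).sub_const (ν ^ 2)).sqrt h1.ne').congr_deriv (by
    have := sqrt_pos.2 h1
    field_simp
    norm_num)

theorem hasDerivAt_besselPhase {ν t : ℝ} (hν : 0 ≤ ν) (ht : ν < t) :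
    HasDerivAt (besselPhase ν) (√(t ^ 2 - ν ^ 2) / t) t := by
  have ht0 : 0 < t := hν.trans_lt ht
  have h1 : 0 < t ^ 2 - ν ^ 2 := by nlinarith
  have hs := sqrt_pos.2 h1
  have h2 : HasDerivAt (fun t : ℝ => ν / t) (-ν / t ^ 2) t :=
    ((hasDerivAt_const t ν).fun_div (hasDerivAt_id t) ht0.ne').congr_deriv (by simp)
  have h3 : ν / t < 1 := (div_lt_one ht0).2 ht
  have h4 : 0 ≤ ν / t := by positivity
  have h5 := (hasDerivAt_arccos (by linarith) h3.ne).comp t h2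
  refine ((hasDerivAt_sqrt_sq_sub_sq hν ht).sub (h5.const_mul ν)).congr_deriv ?_
  rw [sqrt_one_sub_div_sq ht0]
  have := sq_sqrt h1.le
  field_simp
  linarith

theorem hasDerivAt_besselPhase_left {ν t : ℝ} (hν : 0 ≤ ν) (ht : ν < t) :
    HasDerivAt (fun ν => besselPhase ν t) (-arccos (ν / t)) ν := by
  have ht0 : 0 < t := hν.trans_lt ht
  have h1 : 0 < t ^ 2 - ν ^ 2 := by nlinarith
  have hs := sqrt_pos.2 h1
  have h3 : ν / t < 1 := (div_lt_one ht0).2 ht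
  have h4 : 0 ≤ ν / t := by positivity
  have h5 := (hasDerivAt_arccos (by linarith) h3.ne).comp ν ((hasDerivAt_id ν).div_const t)
  have h6 := (((hasDerivAt_pow 2 ν).const_sub (t ^ 2)).sqrt h1.ne')
  refine (h6.sub ((hasDerivAt_id ν).mul h5)).congr_deriv ?_
  simp only [id, Function.comp]
  rw [sqrt_one_sub_div_sq ht0]
  field_simp
  norm_num
  ring

/-- The fourth root `(t² - ν²)^{1/4}`, the inverse of the amplitude of `J_ν`. -/
def besselWeight (ν t : ℝ) : ℝ := √√(t ^ 2 - ν ^ 2)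

theorem besselWeight_sq (ν t : ℝ) : besselWeight ν t ^ 2 = √(t ^ 2 - ν ^ 2) :=
  sq_sqrt (sqrt_nonneg _)

theorem besselWeight_pow_four {ν t : ℝ} (hν : 0 ≤ ν) (ht : ν < t) :
    besselWeight ν t ^ 4 = t ^ 2 - ν ^ 2 := by
  have h1 : 0 < t ^ 2 - ν ^ 2 := by nlinarith
  rw [show 4 = 2 * 2 from rfl, pow_mul, besselWeight_sq, sq_sqrt h1.le]

theorem besselWeight_pos {ν t : ℝ} (hν : 0 ≤ ν) (ht : ν < t) : 0 < besselWeight ν t := by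
  have h1 : 0 < t ^ 2 - ν ^ 2 := by nlinarith
  exact sqrt_pos.2 (sqrt_pos.2 h1)

theorem hasDerivAt_besselWeight {ν t : ℝ} (hν : 0 ≤ ν) (ht : ν < t) :
    HasDerivAt (besselWeight ν) (t / (2 * besselWeight ν t ^ 3)) t := by
  have h1 : 0 < t ^ 2 - ν ^ 2 := by nlinarith
  have ha := besselWeight_pos hν ht
  refine ((hasDerivAt_sqrt_sq_sub_sq hν ht).sqrt (sqrt_pos.2 h1).ne').congr_deriv ?_
  change t / √(t ^ 2 - ν ^ 2) / (2 * besselWeight ν t) = _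
  rw [← besselWeight_sq]
  field_simp

/-! ### The Liouville-Green transformation -/

/-- The Liouville-Green variable `P = (t² - n²)^{1/4} J_n`. -/
def lgValue (n : ℕ) (t : ℝ) : ℝ := besselWeight n t * realBesselJ n t

/-- The derivative of `lgValue n` with respect to the phase `besselPhase n`. -/
def lgSlope (n : ℕ) (t : ℝ) : ℝ :=
  t ^ 2 / (2 * besselWeight n t ^ 5) * realBesselJ n t
    + t / besselWeight n t * realBesselJDeriv n t

theorem hasDerivAt_lgValue {n : ℕ} {t : ℝ} (ht : (n : ℝ) < t) :
    HasDerivAt (lgValue n) (√(t ^ 2 - n ^ 2) / t * lgSlope n t) t := by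
  have hn : (0 : ℝ) ≤ n := n.cast_nonneg
  have ht0 : 0 < t := hn.trans_lt ht
  have ha := besselWeight_pos hn ht
  refine ((hasDerivAt_besselWeight hn ht).mul (hasDerivAt_realBesselJ n ht0.ne')).congr_deriv ?_
  rw [lgSlope, ← besselWeight_sq]
  field_simp

/-- Bessel's equation in Liouville-Green variables: a harmonic oscillator in the variable
`besselPhase n`, up to a perturbation that is integrable at infinity. -/
theorem hasDerivAt_lgSlope {n : ℕ} {t : ℝ} (ht : (n : ℝ) < t) :
    HasDerivAt (lgSlope n) (-(√(t ^ 2 - n ^ 2) / t * lgValue n t)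
      + lgValue n t * (t / besselWeight n t ^ 6 - 5 * t ^ 3 / (4 * besselWeight n t ^ 10))) t := by
  have hn : (0 : ℝ) ≤ n := n.cast_nonneg
  have ht0 : 0 < t := hn.trans_lt ht
  have ha := besselWeight_pos hn ht
  have ha' := hasDerivAt_besselWeight hn ht
  have h1 := (hasDerivAt_pow 2 t).fun_div ((ha'.fun_pow 5).const_mul 2) (by positivity)
  have h2 := (hasDerivAt_id' t).fun_div ha' ha.ne'
  refine ((h1.fun_mul (hasDerivAt_realBesselJ n ht0.ne')).fun_add
    (h2.fun_mul (hasDerivAt_realBesselJDeriv n ht0.ne'))).congr_deriv ?_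
  have hQ : 1 - ((n : ℤ) : ℝ) ^ 2 / t ^ 2 = besselWeight n t ^ 4 / t ^ 2 := by
    rw [besselWeight_pow_four hn ht]
    push_cast
    field_simp
  rw [hQ, lgValue, ← besselWeight_sq]
  simp only [Nat.cast_ofNat, Nat.add_one_sub_one, pow_one]
  field_simp
  ring

/-- The Liouville-Green variables in the rotating frame. -/
def lgFrame (n : ℕ) (t : ℝ) : ℂ :=
  Complex.exp (Complex.I * besselPhase n t) * (lgValue n t + Complex.I * lgSlope n t)

theorem norm_exp_I_mul (y : ℝ) : ‖Complex.exp (Complex.I * y)‖ = 1 := by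
  rw [mul_comm, Complex.norm_exp_ofReal_mul_I]

theorem abs_lgValue_le (n : ℕ) (t : ℝ) : |lgValue n t| ≤ ‖lgFrame n t‖ := by
  rw [lgFrame, norm_mul, norm_exp_I_mul, one_mul]
  simpa using Complex.abs_re_le_norm (lgValue n t + Complex.I * lgSlope n t)

theorem abs_lgSlope_le (n : ℕ) (t : ℝ) : |lgSlope n t| ≤ ‖lgFrame n t‖ := by
  rw [lgFrame, norm_mul, norm_exp_I_mul, one_mul]
  simpa using Complex.abs_im_le_norm (lgValue n t + Complex.I * lgSlope n t)

/-- The derivative of `lgFrame n`. -/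
def lgFrameDeriv (n : ℕ) (t : ℝ) : ℂ :=
  Complex.exp (Complex.I * besselPhase n t) * (Complex.I * (lgValue n t *
    (t / besselWeight n t ^ 6 - 5 * t ^ 3 / (4 * besselWeight n t ^ 10)) : ℝ))

theorem hasDerivAt_lgFrame {n : ℕ} {t : ℝ} (ht : (n : ℝ) < t) :
    HasDerivAt (lgFrame n) (lgFrameDeriv n t) t := by
  have h1 := ((hasDerivAt_besselPhase n.cast_nonneg ht).ofReal_comp.const_mul Complex.I).cexp
  have h2 := (hasDerivAt_lgValue ht).ofReal_comp.fun_add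
    ((hasDerivAt_lgSlope ht).ofReal_comp.const_mul Complex.I)
  refine (h1.fun_mul h2).congr_deriv ?_
  rw [lgFrameDeriv]
  push_cast
  linear_combination (Complex.exp (Complex.I * besselPhase n t) *
    (√(t ^ 2 - n ^ 2) : ℝ) / t * lgSlope n t) * Complex.I_sq

theorem norm_lgFrameDeriv_le {n : ℕ} {e t : ℝ} (he : 0 < e) (he1 : e ≤ 1) (ht : 0 < t)
    (hn : (n : ℝ) ≤ (1 - e) * t) : ‖lgFrameDeriv n t‖ ≤ 9 / 4 / e ^ 3 / t ^ 2 * ‖lgFrame n t‖ := by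
  have hn0 : (0 : ℝ) ≤ n := n.cast_nonneg
  have hnt : (n : ℝ) < t := by nlinarith
  have ha := besselWeight_pos hn0 hnt
  have ha4 := besselWeight_pow_four hn0 hnt
  set a := besselWeight n t with ha_def
  have h4 : e * t ^ 2 ≤ a ^ 4 := by
    have h1 : (n : ℝ) ^ 2 ≤ ((1 - e) * t) ^ 2 := by gcongr
    have h2 : 0 ≤ t ^ 2 * (e * (1 - e)) := by
      have : 0 ≤ 1 - e := by linarith
      positivity
    rw [ha4]
    nlinarith
  have h2 : e * t ≤ a ^ 2 := by
    refine le_of_sq_le_sq ?_ (by positivity)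
    calc (e * t) ^ 2 = e * (e * t ^ 2) := by ring
      _ ≤ 1 * (e * t ^ 2) := by gcongr
      _ ≤ a ^ 4 := by linarith
      _ = (a ^ 2) ^ 2 := by ring
  have h6 : e ^ 3 * t ^ 3 ≤ a ^ 6 := by
    calc e ^ 3 * t ^ 3 = (e * t) ^ 3 := by ring
      _ ≤ (a ^ 2) ^ 3 := by gcongr
      _ = a ^ 6 := by ring
  have h10 : e ^ 3 * t ^ 5 ≤ a ^ 10 := by
    calc e ^ 3 * t ^ 5 = (e * t ^ 2) * (e * t ^ 2) * (e * t) := by ring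
      _ ≤ a ^ 4 * a ^ 4 * a ^ 2 := by gcongr
      _ = a ^ 10 := by ring
  have hb1 : t / a ^ 6 ≤ 1 / e ^ 3 / t ^ 2 := by
    calc t / a ^ 6 ≤ t / (e ^ 3 * t ^ 3) := by gcongr
      _ = _ := by field_simp
  have hb2 : 5 * t ^ 3 / (4 * a ^ 10) ≤ 5 / 4 / e ^ 3 / t ^ 2 := by
    calc 5 * t ^ 3 / (4 * a ^ 10) ≤ 5 * t ^ 3 / (4 * (e ^ 3 * t ^ 5)) := by gcongr
      _ = _ := by field_simp
  have hb : |t / a ^ 6 - 5 * t ^ 3 / (4 * a ^ 10)| ≤ 9 / 4 / e ^ 3 / t ^ 2 := by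
    calc _ ≤ |t / a ^ 6| + |5 * t ^ 3 / (4 * a ^ 10)| := abs_sub _ _
      _ = t / a ^ 6 + 5 * t ^ 3 / (4 * a ^ 10) := by
        rw [abs_of_nonneg (by positivity), abs_of_nonneg (by positivity)]
      _ ≤ 1 / e ^ 3 / t ^ 2 + 5 / 4 / e ^ 3 / t ^ 2 := add_le_add hb1 hb2
      _ = _ := by ring
  rw [lgFrameDeriv, norm_mul, norm_exp_I_mul, one_mul, norm_mul, Complex.norm_I, one_mul,
    Complex.norm_real, norm_mul, norm_eq_abs, norm_eq_abs, mul_comm]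
  gcongr
  exact abs_lgValue_le n t

/-- The constant in the error bounds for `lgFrame` on the region `n ≤ (1 - e) t`, `t ≥ 1 / 2`. -/
def lgConst (e : ℝ) : ℝ := 9 / 4 / e ^ 3 * exp (9 / 4 / e ^ 3 / (1 / 2))

theorem norm_lgFrame_sub_le {n : ℕ} {e x t : ℝ} (he : 0 < e) (he1 : e ≤ 1) (hx : 1 / 2 ≤ x)
    (hn : (n : ℝ) ≤ (1 - e) * x) (ht : x ≤ t) :
    ‖lgFrame n t - lgFrame n x‖ ≤ lgConst e * ‖lgFrame n x‖ / x := by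
  have hx0 : 0 < x := by linarith
  have hn' : ∀ s, x ≤ s → (n : ℝ) ≤ (1 - e) * s := fun s hs =>
    hn.trans (mul_le_mul_of_nonneg_left hs (by linarith))
  refine (norm_sub_le_of_norm_deriv_le_div_sq (f := lgFrame n) (f' := lgFrameDeriv n)
    (K := 9 / 4 / e ^ 3) (by positivity) hx0 (fun s hs => hasDerivAt_lgFrame ?_)
    (fun s hs => norm_lgFrameDeriv_le he he1 (hx0.trans_le hs) (hn' s hs)) ht).trans ?_
  · nlinarith [hn' s hs]
  · rw [lgConst]
    gcongr

/-! ### Behaviour at infinity -/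

theorem tendsto_besselWeight_div_sqrt (n : ℕ) :
    Tendsto (fun t => besselWeight n t / √t) atTop (𝓝 1) := by
  have h : Tendsto (fun t : ℝ => √√(1 - ((n : ℝ) / t) ^ 2)) atTop (𝓝 1) := by
    have h0 : Tendsto (fun t : ℝ => (n : ℝ) / t) atTop (𝓝 0) :=
      tendsto_const_nhds.div_atTop tendsto_id
    simpa using ((h0.pow 2).const_sub 1).sqrt.sqrt
  refine h.congr' ?_
  filter_upwards [eventually_gt_atTop 0] with t ht
  rw [sqrt_one_sub_div_sq ht, sqrt_div (sqrt_nonneg _), besselWeight]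

theorem tendsto_besselPhase_sub (n : ℕ) :
    Tendsto (fun t => besselPhase n t - (t - n * (π / 2))) atTop (𝓝 0) := by
  have h0 : Tendsto (fun t : ℝ => (n : ℝ) / t) atTop (𝓝 0) :=
    tendsto_const_nhds.div_atTop tendsto_id
  have h1 : Tendsto (fun t : ℝ => arccos ((n : ℝ) / t)) atTop (𝓝 (π / 2)) := by
    have := (continuous_arccos.tendsto 0).comp h0
    rwa [arccos_zero] at this
  have h2 : Tendsto (fun t : ℝ => √(t ^ 2 - (n : ℝ) ^ 2) - t) atTop (𝓝 0) := by
    have h3 : Tendsto (fun t : ℝ => (n : ℝ) ^ 2 / t) atTop (𝓝 0) :=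
      tendsto_const_nhds.div_atTop tendsto_id
    refine squeeze_zero_norm' ?_ h3
    filter_upwards [eventually_gt_atTop (n : ℝ)] with t ht
    have ht0 : 0 < t := (n.cast_nonneg : (0 : ℝ) ≤ n).trans_lt ht
    have h4 : 0 < t ^ 2 - (n : ℝ) ^ 2 := by nlinarith [(n.cast_nonneg : (0 : ℝ) ≤ n)]
    have h5 := sq_sqrt h4.le
    have h6 := sqrt_nonneg (t ^ 2 - (n : ℝ) ^ 2)
    have h7 : √(t ^ 2 - (n : ℝ) ^ 2) ≤ t := by
      rw [sqrt_le_left ht0.le]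
      nlinarith
    rw [norm_eq_abs, abs_of_nonpos (by linarith), le_div_iff₀ ht0]
    nlinarith
  have h7 := h2.sub (((h1.sub_const (π / 2)).const_mul (n : ℝ)))
  simp only [sub_self, mul_zero] at h7
  refine h7.congr fun t => ?_
  rw [besselPhase]
  ring

theorem isBigO_lgFrame (n : ℕ) : lgFrame n =O[atTop] (fun _ => (1 : ℝ)) := by
  have hx : (1 / 2 : ℝ) ≤ 2 * n + 1 := by linarith [(n.cast_nonneg : (0 : ℝ) ≤ n)]
  refine IsBigO.of_bound (‖lgFrame n (2 * n + 1)‖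
    + lgConst (1 / 2) * ‖lgFrame n (2 * n + 1)‖ / (2 * n + 1)) ?_
  filter_upwards [eventually_ge_atTop (2 * n + 1 : ℝ)] with t ht
  have h := norm_lgFrame_sub_le (n := n) (e := 1 / 2) (by norm_num) (by norm_num) hx
    (by linarith) ht
  have h2 := norm_le_norm_add_norm_sub' (lgFrame n t) (lgFrame n (2 * n + 1))
  simp only [norm_one, mul_one]
  linarith

theorem isBigO_lgValue (n : ℕ) : lgValue n =O[atTop] (fun _ => (1 : ℝ)) :=
  (IsBigO.of_norm_le fun t => by simpa using abs_lgValue_le n t : lgValue n =O[atTop]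
    fun t => ‖lgFrame n t‖).trans (isBigO_lgFrame n).norm_left

theorem isBigO_lgSlope (n : ℕ) : lgSlope n =O[atTop] (fun _ => (1 : ℝ)) :=
  (IsBigO.of_norm_le fun t => by simpa using abs_lgSlope_le n t : lgSlope n =O[atTop]
    fun t => ‖lgFrame n t‖).trans (isBigO_lgFrame n).norm_left

/-- The coefficient of `√t J_n` in `lgSlope n`. -/
def lgCoeff (n : ℕ) (t : ℝ) : ℝ := t ^ 2 / (2 * besselWeight n t ^ 5) / √t

theorem tendsto_lgCoeff (n : ℕ) : Tendsto (lgCoeff n) atTop (𝓝 0) := by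
  have h1 := (((tendsto_besselWeight_div_sqrt n).pow 5).const_mul 2)
  have h2 : Tendsto (fun t : ℝ => 1 / (2 * (besselWeight n t / √t) ^ 5) / t) atTop (𝓝 0) :=
    (tendsto_const_nhds.div h1 (by norm_num)).div_atTop tendsto_id
  refine h2.congr' ?_
  filter_upwards [eventually_gt_atTop (n : ℝ)] with t ht
  have hn : (0 : ℝ) ≤ n := n.cast_nonneg
  have ht0 : 0 < t := hn.trans_lt ht
  have ha := besselWeight_pos hn ht
  have hs := sqrt_pos.2 ht0
  obtain ⟨s, hs0, rfl⟩ : ∃ s : ℝ, 0 < s ∧ t = s ^ 2 := ⟨√t, hs, (sq_sqrt ht0.le).symm⟩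
  rw [lgCoeff, sqrt_sq hs0.le]
  field_simp

theorem lgValue_eq {n : ℕ} {t : ℝ} (ht : 0 < t) :
    lgValue n t = besselWeight n t / √t * (√t * realBesselJ n t) := by
  have := sqrt_pos.2 ht
  rw [lgValue]
  field_simp

theorem lgSlope_eq {n : ℕ} {t : ℝ} (ht : (n : ℝ) < t) :
    lgSlope n t = lgCoeff n t * (√t * realBesselJ n t)
      + (besselWeight n t / √t)⁻¹ * (√t * realBesselJDeriv n t) := by
  have hn : (0 : ℝ) ≤ n := n.cast_nonneg
  have ht0 : 0 < t := hn.trans_lt ht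
  have ha := besselWeight_pos hn ht
  have := sqrt_pos.2 ht0
  have h2 := mul_self_sqrt ht0.le
  rw [lgSlope, lgCoeff, inv_div, ← mul_assoc, ← mul_assoc, div_mul_cancel₀ _ this.ne',
    div_mul_eq_mul_div _ _ √t, h2]

theorem isBigO_sqrt_mul_realBesselJ (n : ℕ) :
    (fun t => √t * realBesselJ n t) =O[atTop] (fun _ => (1 : ℝ)) := by
  have h := (((tendsto_besselWeight_div_sqrt n).inv₀ one_ne_zero).isBigO_one ℝ).mul
    (isBigO_lgValue n)
  simp only [mul_one] at h
  refine h.congr' ?_ .rfl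
  filter_upwards [eventually_gt_atTop (n : ℝ)] with t ht
  have hn : (0 : ℝ) ≤ n := n.cast_nonneg
  have ht0 : 0 < t := hn.trans_lt ht
  have ha := besselWeight_pos hn ht
  have := sqrt_pos.2 ht0
  rw [lgValue_eq ht0, inv_mul_cancel_left₀ (by positivity)]

theorem isBigO_sqrt_mul_realBesselJDeriv (n : ℕ) :
    (fun t => √t * realBesselJDeriv n t) =O[atTop] (fun _ => (1 : ℝ)) := by
  have h := ((tendsto_besselWeight_div_sqrt n).isBigO_one ℝ).mul
    ((isBigO_lgSlope n).sub
      (((tendsto_lgCoeff n).isBigO_one ℝ).mul (isBigO_sqrt_mul_realBesselJ n) |>.congr_right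
        fun _ => mul_one _))
  simp only [mul_one] at h
  refine h.congr' ?_ .rfl
  filter_upwards [eventually_gt_atTop (n : ℝ)] with t ht
  have hn : (0 : ℝ) ≤ n := n.cast_nonneg
  have ht0 : 0 < t := hn.trans_lt ht
  have ha := besselWeight_pos hn ht
  have := sqrt_pos.2 ht0
  rw [lgSlope_eq ht, add_sub_cancel_left, mul_inv_cancel_left₀ (by positivity)]

/-- The rotated vector `√t (J_n + i J_n')`, which `lgFrame n` approaches at infinity. -/
def besselVector (n : ℕ) (t : ℝ) : ℂ :=
  Complex.exp (Complex.I * (t - n * (π / 2) : ℝ))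
    * ((√t * realBesselJ n t : ℝ) + Complex.I * (√t * realBesselJDeriv n t : ℝ))

theorem tendsto_mul_zero_of_isBigO {f g : ℝ → ℝ} (hf : Tendsto f atTop (𝓝 0))
    (hg : g =O[atTop] (fun _ => (1 : ℝ))) : Tendsto (fun t => f t * g t) atTop (𝓝 0) := by
  have := ((isLittleO_one_iff ℝ).2 hf).mul_isBigO hg
  simp only [mul_one] at this
  exact (isLittleO_one_iff ℝ).1 this

theorem tendsto_lgFrame_sub_besselVector (n : ℕ) :
    Tendsto (fun t => lgFrame n t - besselVector n t) atTop (𝓝 0) := by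
  have hρ := tendsto_besselWeight_div_sqrt n
  have hA := isBigO_sqrt_mul_realBesselJ n
  have hD := isBigO_sqrt_mul_realBesselJDeriv n
  have h1 := tendsto_mul_zero_of_isBigO (by simpa using hρ.sub_const 1) hA
  have h2 := tendsto_mul_zero_of_isBigO (tendsto_lgCoeff n) hA
  have h3 := tendsto_mul_zero_of_isBigO (f := fun t => (besselWeight n t / √t)⁻¹ - 1)
    (by simpa using (hρ.inv₀ one_ne_zero).sub_const 1) hD
  have h4 : Tendsto (fun t : ℝ => ‖Complex.exp (Complex.I * besselPhase n t)
      - Complex.exp (Complex.I * (t - n * (π / 2) : ℝ))‖) atTop (𝓝 0) := by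
    have hc : Continuous fun y : ℝ => ‖Complex.exp (Complex.I * y) - 1‖ := by fun_prop
    have h5 := (hc.tendsto 0).comp (tendsto_besselPhase_sub n)
    simp only [Complex.ofReal_zero, mul_zero, Complex.exp_zero, sub_self, norm_zero] at h5
    refine h5.congr fun t => ?_
    simp only [Function.comp]
    have h6 : Complex.exp (Complex.I * besselPhase n t)
        - Complex.exp (Complex.I * (t - n * (π / 2) : ℝ))
        = Complex.exp (Complex.I * (t - n * (π / 2) : ℝ)) * (Complex.exp
          (Complex.I * ((besselPhase n t - (t - n * (π / 2)) : ℝ) : ℂ)) - 1) := by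
      rw [mul_sub, ← Complex.exp_add]
      push_cast
      ring_nf
    rw [h6, norm_mul, norm_exp_I_mul, one_mul]
  have h5 := (h1.abs.add (h2.abs.add h3.abs)).add
    ((tendsto_mul_zero_of_isBigO h4 hA.norm_left).add
      (tendsto_mul_zero_of_isBigO h4 hD.norm_left))
  simp only [abs_zero, add_zero] at h5
  refine squeeze_zero_norm' ?_ h5
  filter_upwards [eventually_gt_atTop (n : ℝ)] with t ht
  have ht0 : 0 < t := (n.cast_nonneg : (0 : ℝ) ≤ n).trans_lt ht
  rw [lgFrame, besselVector, lgSlope_eq ht, lgValue_eq ht0]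
  generalize √t * realBesselJ n t = A
  generalize √t * realBesselJDeriv n t = D
  generalize besselWeight n t / √t = ρ
  generalize lgCoeff n t = κ
  have h7 := norm_exp_I_mul (besselPhase n t)
  revert h7
  generalize Complex.exp (Complex.I * besselPhase n t) = u
  generalize Complex.exp (Complex.I * (t - n * (π / 2) : ℝ)) = v
  intro h7
  have h8 : u * (((ρ * A : ℝ) : ℂ) + Complex.I * (κ * A + ρ⁻¹ * D : ℝ)) - v * (A + Complex.I * D)
      = u * (((ρ - 1) * A : ℝ) + Complex.I * (((κ * A : ℝ) : ℂ) + ((ρ⁻¹ - 1) * D : ℝ)))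
        + ((u - v) * A + (u - v) * (Complex.I * D)) := by
    push_cast
    ring
  rw [h8]
  refine (norm_add_le _ _).trans (add_le_add ?_ ((norm_add_le _ _).trans (add_le_add ?_ ?_)))
  · rw [norm_mul, h7, one_mul]
    refine (norm_add_le _ _).trans (add_le_add ?_ ?_)
    · rw [Complex.norm_real, norm_eq_abs]
    · rw [norm_mul, Complex.norm_I, one_mul]
      refine (norm_add_le _ _).trans (add_le_add ?_ ?_) <;> rw [Complex.norm_real, norm_eq_abs]
  · rw [norm_mul, Complex.norm_real]
  · rw [norm_mul, norm_mul, Complex.norm_I, one_mul, Complex.norm_real]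

/-- By the recurrences, `J_{n+1} + i J_{n+1}'` is `i (J_n + i J_n')` up to a factor `O(1 / t)`. -/
theorem tendsto_besselVector_succ_sub (n : ℕ) :
    Tendsto (fun t => besselVector (n + 1) t - besselVector n t) atTop (𝓝 0) := by
  have hlim : ∀ a : ℝ, Tendsto (fun t : ℝ => a / t) atTop (𝓝 0) := fun a =>
    tendsto_const_nhds.div_atTop tendsto_id
  have h1 := tendsto_mul_zero_of_isBigO (hlim n) (isBigO_sqrt_mul_realBesselJ n)
  have h2 := tendsto_mul_zero_of_isBigO (hlim (n + 1)) (isBigO_sqrt_mul_realBesselJ (n + 1))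
  have h3 := h1.abs.add h2.abs
  simp only [abs_zero, add_zero, Nat.cast_add, Nat.cast_one] at h3
  refine squeeze_zero_norm' ?_ h3
  filter_upwards [eventually_gt_atTop 0] with t ht
  have hexp : Complex.exp (Complex.I * (t - n * (π / 2) : ℝ))
      = Complex.I * Complex.exp (Complex.I * (t - (n + 1 : ℕ) * (π / 2) : ℝ)) := by
    have : (Complex.I * (t - n * (π / 2) : ℝ) : ℂ)
        = π / 2 * Complex.I + Complex.I * (t - (n + 1 : ℕ) * (π / 2) : ℝ) := by
      push_cast
      ring
    rw [this, Complex.exp_add, Complex.exp_pi_div_two_mul_I]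
  have hD1 := realBesselJDeriv_add_one n ht.ne'
  have hD0 : realBesselJDeriv n t = n / t * realBesselJ n t - realBesselJ (n + 1) t := by
    rw [realBesselJDeriv]
    simp
  have h4 : besselVector (n + 1) t - besselVector n t
      = Complex.exp (Complex.I * (t - (n + 1 : ℕ) * (π / 2) : ℝ)) *
        ((n / t * (√t * realBesselJ n t) : ℝ)
          + (-Complex.I) * ((n + 1) / t * (√t * realBesselJ (n + 1) t) : ℝ)) := by
    rw [besselVector, besselVector, hexp]
    push_cast [hD0, hD1]
    linear_combination (-(Complex.exp (Complex.I * (t - (n + 1) * (π / 2))) * √t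
      * (n / t * realBesselJ n t - realBesselJ (n + 1) t))) * Complex.I_sq
  rw [h4, norm_mul, norm_exp_I_mul, one_mul]
  refine (norm_add_le _ _).trans (add_le_add ?_ ?_)
  · rw [Complex.norm_real, norm_eq_abs]
  · rw [norm_mul, norm_neg, Complex.norm_I, one_mul, Complex.norm_real, norm_eq_abs]

theorem exists_tendsto_lgFrame_zero : ∃ c : ℂ, c ≠ 0 ∧ Tendsto (lgFrame 0) atTop (𝓝 c) := by
  have hE : ∀ {x t : ℝ}, 1 / 2 ≤ x → x ≤ t →
      ‖lgFrame 0 t - lgFrame 0 x‖ ≤ lgConst 1 * ‖lgFrame 0 x‖ / x := fun hx ht =>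
    norm_lgFrame_sub_le one_pos le_rfl hx (by simp) ht
  have hK : 0 < lgConst 1 := by rw [lgConst]; positivity
  obtain ⟨M, hM⟩ := (isBigO_lgFrame 0).bound
  simp only [norm_one, mul_one] at hM
  obtain ⟨T, hT⟩ := eventually_atTop.1 hM
  have hcauchy : CauchySeq (lgFrame 0) := by
    rw [Metric.cauchySeq_iff']
    intro δ hδ
    have h1 : Tendsto (fun x : ℝ => lgConst 1 * M / x) atTop (𝓝 0) :=
      tendsto_const_nhds.div_atTop tendsto_id
    obtain ⟨x, hx1, hx2, hx3⟩ := ((h1.eventually (gt_mem_nhds hδ)).and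
      ((eventually_ge_atTop (1 / 2)).and (eventually_ge_atTop T))).exists
    refine ⟨x, fun t ht => ?_⟩
    rw [dist_eq_norm]
    refine ((hE hx2 ht).trans ?_).trans_lt hx1
    have := hT x hx3
    have : 0 < x := by linarith
    gcongr
  obtain ⟨c, hc⟩ := cauchySeq_tendsto_of_complete hcauchy
  refine ⟨c, ?_, hc⟩
  rintro rfl
  set x := lgConst 1 + 1 with hx
  have hx0 : 0 < x := by positivity
  have h1 : ‖(0 : ℂ) - lgFrame 0 x‖ ≤ lgConst 1 * ‖lgFrame 0 x‖ / x :=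
    le_of_tendsto (hc.sub_const _).norm (eventually_atTop.2 ⟨x, fun t ht => hE (by linarith) ht⟩)
  rw [zero_sub, norm_neg, le_div_iff₀ hx0] at h1
  have h2 : ‖lgFrame 0 x‖ = 0 := by nlinarith [norm_nonneg (lgFrame 0 x)]
  have h3 : lgValue 0 x = 0 := abs_nonpos_iff.1 (h2 ▸ abs_lgValue_le 0 x)
  have h4 : lgSlope 0 x = 0 := abs_nonpos_iff.1 (h2 ▸ abs_lgSlope_le 0 x)
  have ha := besselWeight_pos (le_refl 0) hx0
  have h5 : realBesselJ 0 x = 0 := by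
    rw [lgValue] at h3
    simpa [ha.ne'] using h3
  have h6 : realBesselJDeriv 0 x = 0 := by
    rw [lgSlope] at h4
    simpa [ha.ne', h5, hx0.ne'] using h4
  have := realBesselJ_zero_sq_add_pos hx0
  simp [h5, h6] at this

/-- All the frames `lgFrame n` have the same nonzero limit at infinity. -/
theorem exists_tendsto_lgFrame : ∃ c : ℂ, c ≠ 0 ∧ ∀ n, Tendsto (lgFrame n) atTop (𝓝 c) := by
  obtain ⟨c, hc, h0⟩ := exists_tendsto_lgFrame_zero
  refine ⟨c, hc, fun n => ?_⟩
  induction n with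
  | zero => exact h0
  | succ n ih =>
    have h := ((ih.sub (tendsto_lgFrame_sub_besselVector n)).add
      (tendsto_besselVector_succ_sub n)).add (tendsto_lgFrame_sub_besselVector (n + 1))
    simp only [sub_zero, add_zero] at h
    exact h.congr fun t => by ring

/-! ### The phase at the zeros -/

theorem exists_abs_sub_int_mul_pi_le (y : ℝ) : ∃ k : ℤ, |y - k * π| ≤ π / 2 * |sin y| := by
  have hπ := pi_pos
  refine ⟨round (y / π), ?_⟩
  set k := round (y / π)
  have h1 : |y - k * π| ≤ π / 2 := by
    have h2 := abs_sub_round (y / π)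
    have h3 : y - k * π = (y / π - k) * π := by field_simp
    rw [h3, abs_mul, abs_of_pos hπ]
    calc |y / π - k| * π ≤ 1 / 2 * π := by gcongr
      _ = π / 2 := by ring
  have h2 : |sin y| = |sin (y - k * π)| := by
    rw [sin_sub_int_mul_pi, abs_mul, abs_zpow, abs_neg, abs_one, one_zpow, one_mul]
  have h3 := mul_abs_le_abs_sin h1
  rw [h2]
  calc |y - k * π| = π / 2 * (2 / π * |y - k * π|) := by field_simp
    _ ≤ _ := by gcongr

/-- Up to multiples of `π`, the phase at a zero of `J_n` is a constant that does not depend on `n`,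
with an error `O(1 / x)` that is uniform away from the turning point `x = n`. -/
theorem exists_besselPhase_zero : ∃ ψ : ℝ, ∀ e : ℝ, 0 < e → e ≤ 1 → ∃ K : ℝ, 0 < K ∧
    ∀ (n : ℕ) (x : ℝ), 1 / 2 ≤ x → (n : ℝ) ≤ (1 - e) * x → realBesselJ n x = 0 →
      ∃ k : ℤ, |besselPhase n x - ψ - k * π| ≤ K / x := by
  obtain ⟨c, hc, hlim⟩ := exists_tendsto_lgFrame
  refine ⟨c.arg + π / 2, fun e he he1 => ⟨π * lgConst e, ?_, fun n x hx hn hJ => ?_⟩⟩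
  · have := pi_pos
    rw [lgConst]
    positivity
  have hx0 : 0 < x := by linarith
  set K := lgConst e with hKdef
  have hK : 0 < K := by rw [hKdef, lgConst]; positivity
  set θ := besselPhase n x with hθ
  set R := lgSlope n x with hR
  have hE : lgFrame n x = Complex.exp (Complex.I * θ) * (Complex.I * R) := by
    rw [lgFrame, lgValue, hJ, mul_zero, Complex.ofReal_zero, zero_add]
  have h1 : ‖c - lgFrame n x‖ ≤ K * |R| / x := by
    have h2 : ‖lgFrame n x‖ = |R| := by
      rw [hE, norm_mul, norm_exp_I_mul, one_mul, norm_mul, Complex.norm_I, one_mul,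
        Complex.norm_real, norm_eq_abs]
    rw [← h2]
    exact le_of_tendsto ((hlim n).sub_const _).norm
      (eventually_atTop.2 ⟨x, fun t ht => norm_lgFrame_sub_le he he1 hx hn ht⟩)
  have hcn : 0 < ‖c‖ := norm_pos_iff.2 hc
  -- Rotating by `-θ` and taking real parts removes the term `i R`.
  have hcos : ‖c‖ * |cos (c.arg - θ)| ≤ K * |R| / x := by
    have h3 : ‖c - lgFrame n x‖ = ‖(‖c‖ : ℂ) * Complex.exp ((c.arg - θ : ℝ) * Complex.I)
        - Complex.I * R‖ := by
      have h4 : (‖c‖ : ℂ) * Complex.exp ((c.arg - θ : ℝ) * Complex.I) - Complex.I * R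
          = Complex.exp (Complex.I * (-θ : ℝ)) * (c - lgFrame n x) := by
        rw [mul_sub, hE, ← mul_assoc, ← Complex.exp_add]
        conv_rhs => rw [← Complex.norm_mul_exp_arg_mul_I c]
        rw [mul_left_comm, ← Complex.exp_add]
        push_cast
        ring_nf
        simp
      rw [h4, norm_mul, norm_exp_I_mul, one_mul]
    rw [h3] at h1
    refine le_trans (le_of_eq ?_) ((Complex.abs_re_le_norm _).trans h1)
    rw [Complex.sub_re, Complex.re_ofReal_mul, Complex.exp_ofReal_mul_I_re]
    simp
  have hRc : |R| * (1 - K / x) ≤ ‖c‖ := by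
    have h5 : ‖lgFrame n x‖ = |R| := by
      rw [hE, norm_mul, norm_exp_I_mul, one_mul, norm_mul, Complex.norm_I, one_mul,
        Complex.norm_real, norm_eq_abs]
    have h6 := norm_sub_norm_le (lgFrame n x) c
    rw [norm_sub_rev] at h6
    calc |R| * (1 - K / x) = |R| - K * |R| / x := by ring
      _ ≤ ‖c‖ := by linarith
  have hfin : |cos (c.arg - θ)| ≤ 2 * (K / x) := by
    rcases le_or_gt (1 / 2) (K / x) with h | h
    · linarith [abs_cos_le_one (c.arg - θ)]
    · have h7 : |R| ≤ 2 * ‖c‖ := by nlinarith [abs_nonneg R]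
      have h8 : ‖c‖ * |cos (c.arg - θ)| ≤ ‖c‖ * (2 * (K / x)) := by
        calc _ ≤ K * |R| / x := hcos
          _ ≤ K * (2 * ‖c‖) / x := by gcongr
          _ = _ := by ring
      exact le_of_mul_le_mul_left h8 hcn
  obtain ⟨k, hk⟩ := exists_abs_sub_int_mul_pi_le (θ - (c.arg + π / 2))
  refine ⟨k, hk.trans ?_⟩
  have h9 : sin (θ - (c.arg + π / 2)) = -cos (c.arg - θ) := by
    rw [← sub_sub, sin_sub_pi_div_two, ← cos_neg, neg_sub]
  rw [h9, abs_neg]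
  calc π / 2 * |cos (c.arg - θ)| ≤ π / 2 * (2 * (K / x)) := by have := pi_pos; gcongr
    _ = π * K / x := by ring

/-! ### Second differences of the phase -/

/-- The second difference `h(p) + h(p + s + t) - h(p + s) - h(p + t)` is of size `s t` when `h'` has
slopes between `m` and `M`. -/
theorem second_difference_mem_Icc {h h' : ℝ → ℝ} {p s t m M : ℝ} (hs : 0 < s) (ht : 0 ≤ t)
    (hd : ∀ y ∈ Set.Icc p (p + s + t), HasDerivAt h (h' y) y)
    (hm : ∀ y₁ ∈ Set.Icc p (p + s + t), ∀ y₂ ∈ Set.Icc p (p + s + t), y₁ ≤ y₂ →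
      h' y₂ - h' y₁ ∈ Set.Icc (m * (y₂ - y₁)) (M * (y₂ - y₁))) :
    h p + h (p + s + t) - h (p + s) - h (p + t) ∈ Set.Icc (m * (s * t)) (M * (s * t)) := by
  have hg : ∀ y ∈ Set.Icc p (p + s), HasDerivAt (fun y => h (y + t) - h y)
      (h' (y + t) - h' y) y := fun y hy =>
    ((hd (y + t) ⟨by linarith [hy.1], by linarith [hy.2]⟩).comp_add_const y t).sub
      (hd y ⟨hy.1, by linarith [hy.2]⟩)
  obtain ⟨ξ, hξ, he⟩ := exists_hasDerivAt_eq_slope (fun y => h (y + t) - h y)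
    (fun y => h' (y + t) - h' y) (show p < p + s by linarith)
    (fun y hy => (hg y hy).continuousAt.continuousWithinAt)
    (fun y hy => hg y ⟨hy.1.le, hy.2.le⟩)
  have hb := hm ξ ⟨hξ.1.le, by linarith [hξ.2]⟩ (ξ + t) ⟨by linarith [hξ.1], by linarith [hξ.2]⟩
    (by linarith)
  rw [add_sub_cancel_left] at hb
  rw [add_sub_cancel_left, eq_div_iff hs.ne'] at he
  have h1 : h p + h (p + s + t) - h (p + s) - h (p + t) = (h' (ξ + t) - h' ξ) * s := by
    rw [he]
    ring
  rw [h1]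
  constructor
  · nlinarith [mul_le_mul_of_nonneg_right hb.1 hs.le]
  · nlinarith [mul_le_mul_of_nonneg_right hb.2 hs.le]

theorem arccos_sub_arccos_mem_Icc {e u v : ℝ} (he : 0 < e) (hu : 0 ≤ u) (huv : u ≤ v)
    (hv : v ≤ 1 - e) : arccos u - arccos v ∈ Set.Icc (v - u) (1 / e * (v - u)) := by
  rcases huv.eq_or_lt with rfl | huv
  · simp
  obtain ⟨ξ, hξ, h⟩ := exists_hasDerivAt_eq_slope arccos (fun y => -(1 / √(1 - y ^ 2))) huv
    continuous_arccos.continuousOn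
    (fun y hy => hasDerivAt_arccos (by linarith [hy.1]) (by linarith [hy.2]))
  have hξ0 : 0 ≤ ξ := hu.trans hξ.1.le
  have hξ1 : ξ ≤ 1 - e := hξ.2.le.trans hv
  have h1 : e ≤ √(1 - ξ ^ 2) := by
    apply le_sqrt_of_sq_le
    nlinarith
  have h2 : √(1 - ξ ^ 2) ≤ 1 := by
    rw [sqrt_le_left zero_le_one]
    nlinarith
  have h3 : 1 / √(1 - ξ ^ 2) ≤ 1 / e := by gcongr
  have h4 : 1 ≤ 1 / √(1 - ξ ^ 2) := by
    rw [le_div_iff₀ (he.trans_le h1)]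
    linarith
  have hd : 0 < v - u := sub_pos.2 huv
  rw [eq_div_iff hd.ne'] at h
  constructor <;> nlinarith

/-- The phase is `1`-Lipschitz in `t`. -/
theorem abs_besselPhase_sub_le {ν x y : ℝ} (hν : 0 ≤ ν) (hx : ν < x) (hxy : x ≤ y) :
    |besselPhase ν y - besselPhase ν x| ≤ y - x := by
  rcases hxy.eq_or_lt with rfl | hxy
  · simp
  have hd : ∀ t ∈ Set.Icc x y, HasDerivAt (besselPhase ν) (√(t ^ 2 - ν ^ 2) / t) t :=
    fun t ht => hasDerivAt_besselPhase hν (hx.trans_le ht.1)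
  obtain ⟨ξ, hξ, h⟩ := exists_hasDerivAt_eq_slope (besselPhase ν) (fun t => √(t ^ 2 - ν ^ 2) / t) hxy
    (fun t ht => (hd t ht).continuousAt.continuousWithinAt) (fun t ht => hd t ⟨ht.1.le, ht.2.le⟩)
  have hξ0 : 0 < ξ := by linarith [hξ.1]
  have h1 : √(ξ ^ 2 - ν ^ 2) / ξ ≤ 1 := by
    rw [div_le_one hξ0, sqrt_le_left hξ0.le]
    nlinarith
  have h2 : 0 ≤ √(ξ ^ 2 - ν ^ 2) / ξ := by positivity
  have h3 : 0 < y - x := sub_pos.2 hxy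
  rw [eq_div_iff h3.ne'] at h
  rw [← h, abs_of_nonneg (by positivity)]
  nlinarith

/-- The mixed second difference of the phase in `ν`, away from the turning point. -/
theorem besselPhase_second_difference_mem_Icc {e L p s t : ℝ} (he : 0 < e)
    (hL : 0 < L) (hp : 0 ≤ p) (hs : 0 < s) (ht : 0 ≤ t) (hpst : p + s + t ≤ (1 - e) * L) :
    besselPhase p L + besselPhase (p + s + t) L - besselPhase (p + s) L - besselPhase (p + t) L
      ∈ Set.Icc (1 / L * (s * t)) (1 / (e * L) * (s * t)) := by
  refine second_difference_mem_Icc (h := fun ν => besselPhase ν L)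
    (h' := fun ν => -arccos (ν / L)) hs ht (fun y hy => ?_) (fun y₁ h₁ y₂ h₂ h₁₂ => ?_)
  · exact hasDerivAt_besselPhase_left (hp.trans hy.1) (by nlinarith [hy.2])
  · have h := arccos_sub_arccos_mem_Icc he (u := y₁ / L) (v := y₂ / L)
      (div_nonneg (hp.trans h₁.1) hL.le) (by gcongr)
      ((div_le_iff₀ hL).2 (h₂.2.trans hpst))
    rw [neg_sub_neg]
    convert h using 2 <;> field_simp

/-! ### The gap for angular indices -/

theorem exists_zero_of_mem_angularIndices {ε lam δ : ℝ} {n : ℤ} (h : n ∈ angularIndices ε lam δ) :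
    0 ≤ n ∧ ∃ x : ℝ, 0 < x ∧ realBesselJ n x = 0 ∧ lam - δ ≤ x ∧ x ≤ lam + δ ∧
      (n : ℝ) ≤ (1 - ε / 2) * x := by
  obtain ⟨⟨k, m⟩, ⟨h0, x, ⟨hx, hJ, -⟩, hmem, hle⟩, rfl⟩ := h
  refine ⟨h0, x, hx, ?_, hmem.1, hmem.2, hle⟩
  rw [← re_besselJ, hJ, Complex.zero_re]

/-- For angular indices the phase at the common argument `lam + δ` is, modulo `π`, a constant up to
`O(δ)`. -/
theorem exists_besselPhase_angularIndices : ∃ ψ : ℝ, ∀ ε : ℝ, 0 < ε → ∃ e : ℝ, 0 < e ∧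
    ∃ K : ℝ, 0 < K ∧ ∀ lam δ : ℝ, 1 ≤ lam → lam⁻¹ ≤ δ → δ ≤ 1 / 2 → ∀ n ∈ angularIndices ε lam δ,
      0 ≤ n ∧ (n : ℝ) ≤ (1 - e) * (lam + δ) ∧
        ∃ k : ℤ, |besselPhase n (lam + δ) - ψ - k * π| ≤ K * δ := by
  obtain ⟨ψ, hψ⟩ := exists_besselPhase_zero
  refine ⟨ψ, fun ε hε => ⟨min (ε / 2) 1, by positivity, ?_⟩⟩
  set e := min (ε / 2) 1
  have he : 0 < e := by positivity
  have he1 : e ≤ 1 := min_le_right _ _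
  obtain ⟨K, hK, hphase⟩ := hψ e he he1
  refine ⟨2 * K + 2, by positivity, fun lam δ hlam hδ hδ2 n hn => ?_⟩
  obtain ⟨hn0, x, hx, hJ, hx1, hx2, hnx⟩ := exists_zero_of_mem_angularIndices hn
  have hnx' : (n : ℝ) ≤ (1 - e) * x :=
    hnx.trans (mul_le_mul_of_nonneg_right (by linarith [min_le_left (ε / 2) 1]) hx.le)
  lift n to ℕ using hn0
  rw [Int.cast_natCast] at *
  refine ⟨by positivity, hnx'.trans (mul_le_mul_of_nonneg_left hx2 (by linarith)), ?_⟩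
  obtain ⟨k, hk⟩ := hphase n x (by linarith) hnx' hJ
  refine ⟨k, ?_⟩
  have h1 := abs_besselPhase_sub_le n.cast_nonneg (show (n : ℝ) < x by nlinarith) hx2
  have h2 : K / x ≤ 2 * K * δ := by
    calc K / x ≤ K / (lam / 2) := by gcongr; linarith
      _ = 2 * K * lam⁻¹ := by field_simp
      _ ≤ _ := by gcongr
  calc _ = |(besselPhase n x - ψ - k * π)
        + (besselPhase n (lam + δ) - besselPhase n x)| := by ring_nf
    _ ≤ _ := abs_add_le _ _
    _ ≤ 2 * K * δ + (lam + δ - x) := add_le_add (hk.trans h2) h1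
    _ ≤ (2 * K + 2) * δ := by linarith

/-- The gap: the second difference of the phase at a parallelogram of angular indices is within
`O(δ)` of a multiple of `π`, and it is comparable to `s t / lam`. If it is too large for that
multiple to be `0`, it is bounded below. -/
theorem exists_gap : ∀ ε : ℝ, 0 < ε → ∃ e : ℝ, 0 < e ∧ ∃ C : ℝ, 0 < C ∧ ∃ δ₀ : ℝ, 0 < δ₀ ∧
    ∀ lam δ : ℝ, 1 ≤ lam → lam⁻¹ ≤ δ → δ ≤ δ₀ → ∀ p s t : ℤ, 0 ≤ s → 0 ≤ t →
      p ∈ angularIndices ε lam δ → p + s ∈ angularIndices ε lam δ →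
      p + t ∈ angularIndices ε lam δ → p + s + t ∈ angularIndices ε lam δ →
      C * (lam * δ) ≤ (s : ℝ) * t → e * lam ≤ (s : ℝ) * t := by
  obtain ⟨ψ, hψ⟩ := exists_besselPhase_angularIndices
  intro ε hε
  obtain ⟨e, he, K, hK, hphase⟩ := hψ ε hε
  refine ⟨e, he, 8 * K + 1, by positivity, min (1 / 2) (1 / (4 * K)), by positivity, ?_⟩
  intro lam δ hlam hδ hδ0 p s t hs ht hp hps hpt hpst hC
  have hδ1 : δ ≤ 1 / 2 := hδ0.trans (min_le_left _ _)
  have hδK : K * δ ≤ 1 / 4 := by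
    calc K * δ ≤ K * (1 / (4 * K)) := by gcongr; exact hδ0.trans (min_le_right _ _)
      _ = 1 / 4 := by field_simp
  have hlam0 : 0 < lam := by linarith
  have hδpos : 0 < δ := (inv_pos.2 hlam0).trans_le hδ
  obtain ⟨hp0, -, k1, hk1⟩ := hphase lam δ hlam hδ hδ1 p hp
  obtain ⟨-, -, k2, hk2⟩ := hphase lam δ hlam hδ hδ1 _ hps
  obtain ⟨-, -, k3, hk3⟩ := hphase lam δ hlam hδ hδ1 _ hpt
  obtain ⟨-, hle, k4, hk4⟩ := hphase lam δ hlam hδ hδ1 _ hpst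
  have hst : 0 < (s : ℝ) * t := (by positivity : 0 < (8 * K + 1) * (lam * δ)).trans_le hC
  have hs' : (0 : ℝ) < s := lt_of_le_of_ne (by exact_mod_cast hs) (fun h => by simp [← h] at hst)
  have ht' : (0 : ℝ) ≤ t := by exact_mod_cast ht
  have hL : 0 < lam + δ := by linarith
  push_cast at hle hk2 hk3 hk4
  have hD := besselPhase_second_difference_mem_Icc he hL (p := p) (s := s) (t := t)
    (by exact_mod_cast hp0) hs' ht' hle
  obtain ⟨hD1, hD2⟩ := hD
  generalize hDdef : besselPhase p (lam + δ) + besselPhase (p + s + t) (lam + δ)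
    - besselPhase (p + s) (lam + δ) - besselPhase (p + t) (lam + δ) = D at hD1 hD2
  rw [abs_le] at hk1 hk2 hk3 hk4
  set N : ℤ := k1 + k4 - k2 - k3 with hN
  have hNr : (N : ℝ) * π = k1 * π + k4 * π - k2 * π - k3 * π := by
    rw [hN]
    push_cast
    ring
  have hDN1 : D - N * π ≤ 4 * (K * δ) := by linarith [hk1.2, hk2.1, hk3.1, hk4.2]
  have hDN2 : -(4 * (K * δ)) ≤ D - N * π := by linarith [hk1.1, hk2.2, hk3.2, hk4.1]
  have hDlow : 4 * (K * δ) < D := by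
    refine lt_of_lt_of_le ?_ hD1
    rw [one_div, inv_mul_eq_div, lt_div_iff₀ hL]
    nlinarith [mul_pos hK hδpos, mul_pos hlam0 hδpos,
      mul_le_mul_of_nonneg_left (show lam + δ ≤ 2 * lam by linarith) (mul_pos hK hδpos).le]
  have hN1 : 1 ≤ N := by
    have : (0 : ℝ) < N * π := by linarith
    have : (0 : ℝ) < N := pos_of_mul_pos_left this pi_pos.le
    exact_mod_cast this
  have hDpi : 1 ≤ D := by
    have h1 : (1 : ℝ) ≤ N := by exact_mod_cast hN1
    have h2 : π ≤ N * π := le_mul_of_one_le_left pi_pos.le h1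
    linarith [pi_gt_three]
  have h3 := hDpi.trans hD2
  rw [one_div, inv_mul_eq_div, le_div_iff₀ (by positivity)] at h3
  nlinarith

end

theorem proposition4p2 (ε : ℝ) (hε : 0 < ε) :
    ∃ C : ℝ, 0 < C ∧ ∃ c : ℝ, 0 < c ∧ ∀ lam δ : ℝ, 1 ≤ lam → lam⁻¹ ≤ δ →
      (∀ n ∈ zeroSumSets ε lam δ,
        C * (lam * δ) ≤ (side n : ℝ) * (base n : ℝ) →
          c * lam ≤ (side n : ℝ) * (base n : ℝ)) ∧
      (∀ n ∈ zeroSumSets ε lam δ, C * (lam * δ) ≤ (side n : ℝ) * (base n : ℝ) →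
        ∀ n' ∈ zeroSumSets ε lam δ, n' 1 = n 1 → n' 2 = n 2 →
          ∀ σ : ℤ, σ = side n' - side n → 0 < σ →
            C * (lam * δ) ≤ (σ : ℝ) * (base n : ℝ) →
              c * lam ≤ (σ : ℝ) * (base n : ℝ)) := by
  obtain ⟨e, he, C, hC, δ₀, hδ₀, hgap⟩ := exists_gap ε hε
  refine ⟨2 * C, by positivity, min (e / 2) (2 * C * δ₀), by positivity, ?_⟩
  intro lam δ hlam hδ
  have hlam0 : 0 < lam := by linarith
  have hδpos : 0 < δ := (inv_pos.2 hlam0).trans_le hδ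
  have hlδ := mul_pos hlam0 hδpos
  rcases le_total δ₀ δ with hbig | hsmall
  -- For `δ ≥ δ₀` the lower bounds in the hypotheses already contain the conclusion.
  · have h : min (e / 2) (2 * C * δ₀) * lam ≤ 2 * C * (lam * δ) := by
      calc min (e / 2) (2 * C * δ₀) * lam ≤ 2 * C * δ₀ * lam := by
            gcongr; exact min_le_right _ _
        _ ≤ 2 * C * δ * lam := by gcongr
        _ = _ := by ring
    exact ⟨fun n _ hn => h.trans hn, fun n _ _ n' _ _ _ σ _ _ hσ => h.trans hσ⟩
  have hc : min (e / 2) (2 * C * δ₀) * lam ≤ e / 2 * lam := by gcongr; exact min_le_left _ _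
  have part1 : ∀ n ∈ zeroSumSets ε lam δ, 2 * C * (lam * δ) ≤ (side n : ℝ) * (base n : ℝ) →
      e * lam ≤ (side n : ℝ) * (base n : ℝ) := by
    rintro n ⟨hn, h01, h12, h23, hsum⟩ hsb
    have hs : 0 ≤ side n := sub_nonneg.2 h01
    have hst : side n ≤ n 2 - n 0 := by rw [side]; linarith
    have hb : (base n : ℝ) = side n + (n 2 - n 0 : ℤ) := by
      rw [← Int.cast_add, base, side]
      congr 1
      linarith
    have hs' : (0 : ℝ) ≤ side n := by exact_mod_cast hs
    have hst' : (side n : ℝ) ≤ (n 2 - n 0 : ℤ) := by exact_mod_cast hst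
    rw [hb] at hsb ⊢
    have h := hgap lam δ hlam hδ hsmall (n 0) (side n) (n 2 - n 0) hs (hs.trans hst) (hn 0)
      (by rw [side, add_sub_cancel]; exact hn 1) (by rw [add_sub_cancel]; exact hn 2)
      (by rw [show n 0 + side n + (n 2 - n 0) = n 3 by rw [side]; linarith]; exact hn 3)
      (by nlinarith)
    nlinarith
  refine ⟨fun n hn hsb => ?_, ?_⟩
  · have := part1 n hn hsb
    have := mul_pos he hlam0
    linarith
  intro n hn hsb n' hn' h1 h2 σ hσ hσ0 hσb
  have hfirst := part1 n hn hsb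
  obtain ⟨hn, h01, h12, h23, hsum⟩ := hn
  obtain ⟨hn', -, -, -, hsum'⟩ := hn'
  have hs : 0 ≤ side n := sub_nonneg.2 h01
  have hsbase : side n ≤ base n := by rw [side, base]; linarith
  have hb : 0 ≤ base n := hs.trans hsbase
  have h0 : n' 0 = n 0 - σ := by rw [hσ, side, side, h1]; ring
  have h3 : n' 3 = n 3 + σ := by linarith
  have hσ' : (0 : ℝ) < σ := by exact_mod_cast hσ0
  have hb' : (0 : ℝ) ≤ base n := by exact_mod_cast hb
  have hs' : (0 : ℝ) ≤ side n := by exact_mod_cast hs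
  have hsbase' : (side n : ℝ) ≤ base n := by exact_mod_cast hsbase
  -- The parallelogram with vertices `n₁ - σ`, `n₁`, `n₄`, `n₄ + σ`.
  have h := hgap lam δ hlam hδ hsmall (n' 0) σ (base n + σ) hσ0.le (by linarith) (hn' 0)
    (by rw [h0, sub_add_cancel]; exact hn 0)
    (by rw [show n' 0 + (base n + σ) = n 3 by rw [h0, base]; ring]; exact hn 3)
    (by rw [show n' 0 + σ + (base n + σ) = n' 3 by rw [h0, h3, base]; ring]; exact hn' 3)
    (by push_cast; nlinarith)
  push_cast at h
  have hpos := mul_pos he hlam0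
  refine hc.trans ?_
  rcases le_total (σ : ℝ) (base n) with hle | hle
  · nlinarith
  · -- Here `σ b ≥ b² ≥ s b`, which the first part bounds below.
    nlinarith
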